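/- For a finite $r$-uniform hypergraph $G$ with nonempty vertex set and a real number $q\ge 1$, let $$\lambda^{(q)}(G)=\max\Big\{\, r\sum_{e\in E(G)}\prod_{v\in e}x_v \;:\; x\in\mathbb{R}^{V(G)},\ \sum_{v\in V(G)}|x_v|^q=1\Big\}$$ be its $q$-spectral radius. An \emph{extension} of $G$ is an $(r+1)$-uniform hypergraph $H$ obtained by adding to each edge $e$ of $G$ one new vertex $v_e\notin V(G)$, where the vertices $v_e$ are not required to be distinct; thus $V(H)=V(G)\cup\{v_e : e\in E(G)\}$ and $E(H)=\{e\cup\{v_e\} : e\in E(G)\}$. If all the $v_e$ are pairwise distinct, this extension is the \emph{generalized power} $G^{r+1}$. Let $G*K_1$ be the hypergraph with vertex set $V(G)\cup\{u\}$, where $u\notin V(G)$ is a single new vertex, and edge set $\{e\cup\{u\} : e\in E(G)\}$. **Theorem.** Let $G$ be a finite $r$-uniform hypergraph with at least one vertex and with no isolated vertices, let $H$ be an extension of $G$, and let $p>r$ be a real number. Then $$\left(\Big(\frac{r+1}{r}\Big)^{p-r}\big(\lambda^{(p)}(G)\big)^p\right)^{1/(p+1)}\le \lambda^{(p+1)}(H)\le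 \left(\frac{(r+1)^{p-r}}{r^{p+1-r}}\right)^{1/(p+1)}\lambda^{(p+1)}(G).$$ Equality holds on the left if and only if $H\cong G^{r+1}$, and equality holds on the right if and only if $H\cong G*K_1$. -/

import Mathlib

namespace Hypergraph

/-- `G` is `r`-uniform: every edge has exactly `r` vertices.
(It is only used for hypergraphs with finitely many vertices.) -/
def IsUniform {α : Type*} (G : Hypergraph α) (r : ℕ) : Prop :=
  ∀ e ∈ E(G), e.ncard = r

/-- The polynomial form `P_G(x) = r ∑_{e ∈ E(G)} ∏_{v ∈ e} x_v` of an `r`-uniform hypergraph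
with finitely many vertices. Only the coordinates `x v` with `v ∈ V(G)` matter. -/
noncomputable def polyForm {α : Type*} (G : Hypergraph α) (r : ℕ) (x : α → ℝ) : ℝ :=
  (r : ℝ) * ∑ᶠ e ∈ E(G), ∏ᶠ v ∈ e, x v

/-- The vectors indexed by `V(G)` of `ℓ^p`-norm one (written as functions on the whole
type, whose values outside `V(G)` are irrelevant). -/
def unitSphere {α : Type*} (G : Hypergraph α) (p : ℝ) : Set (α → ℝ) :=
  {x | ∑ᶠ v ∈ V(G), |x v| ^ p = 1}

/-- The `p`-spectral radius `λ^{(p)}(G) = max_{‖x‖_p = 1} P_G(x)` of an `r`-uniform hypergraph.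
The supremum is a maximum as soon as `V(G)` is finite and nonempty and `0 < p`, see
`isGreatest_pSpectralRadius`. -/
noncomputable def pSpectralRadius {α : Type*} (G : Hypergraph α) (r : ℕ) (p : ℝ) : ℝ :=
  sSup (G.polyForm r '' G.unitSphere p)

/-- `H` is an extension of `G`: each edge `e` of `G` gets one new vertex `f e ∉ V(G)`, and these
new vertices are not required to be distinct. -/
def IsExtension {α : Type*} (G H : Hypergraph α) : Prop :=
  ∃ f : Set α → α, (∀ e ∈ E(G), f e ∉ V(G)) ∧
    V(H) = V(G) ∪ f '' E(G) ∧
    E(H) = (fun e => insert (f e) e) '' E(G)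

/-- The generalized power `G^{r+1}` of an `r`-uniform hypergraph `G`: each edge `e` gets its own
new vertex, here the point `Sum.inr e`. -/
def generalizedPower {α : Type*} (G : Hypergraph α) : Hypergraph (α ⊕ Set α) where
  vertexSet := Sum.inl '' V(G) ∪ Sum.inr '' E(G)
  edgeSet := (fun e => insert (Sum.inr e) (Sum.inl '' e)) '' E(G)
  subset_vertexSet_of_mem_edgeSet' := by
    rintro _ ⟨e, he, rfl⟩ x (rfl | ⟨v, hv, rfl⟩)
    · exact Or.inr ⟨e, he, rfl⟩
    · exact Or.inl ⟨v, G.subset_vertexSet_of_mem_edgeSet' he hv, rfl⟩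

/-- The product `G₁ * G₂`: on the disjoint union of the vertex sets, the edges are the unions
`e ∪ f` with `e ∈ E(G₁)` and `f ∈ E(G₂)`. -/
def starProduct {α β : Type*} (G₁ : Hypergraph α) (G₂ : Hypergraph β) : Hypergraph (α ⊕ β) where
  vertexSet := Sum.inl '' V(G₁) ∪ Sum.inr '' V(G₂)
  edgeSet := {g | ∃ e ∈ E(G₁), ∃ f ∈ E(G₂), g = Sum.inl '' e ∪ Sum.inr '' f}
  subset_vertexSet_of_mem_edgeSet' := by
    rintro _ ⟨e, he, f, hf, rfl⟩
    exact Set.union_subset_union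
      (Set.image_mono (G₁.subset_vertexSet_of_mem_edgeSet' he))
      (Set.image_mono (G₂.subset_vertexSet_of_mem_edgeSet' hf))

/-- `K_1`, as a `1`-uniform hypergraph: one vertex, whose singleton is the only edge. -/
def kOne : Hypergraph Unit where
  vertexSet := Set.univ
  edgeSet := {Set.univ}
  subset_vertexSet_of_mem_edgeSet' := fun _ _ => Set.subset_univ _

/-- Isomorphism of hypergraphs: a bijection between the vertex sets under which a set of vertices
is an edge exactly if its image is. -/
def Isomorphic {α β : Type*} (G : Hypergraph α) (H : Hypergraph β) : Prop :=
  ∃ φ : V(G) ≃ V(H), ∀ S : Set V(G),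
    Subtype.val '' S ∈ E(G) ↔ Subtype.val '' (φ '' S) ∈ E(H)

/-- The supremum defining the `p`-spectral radius is attained. -/
theorem isGreatest_pSpectralRadius {α : Type*} (G : Hypergraph α) (r : ℕ) (p : ℝ)
    (hfin : V(G).Finite) (hne : V(G).Nonempty) (hp : 0 < p) :
    IsGreatest (G.polyForm r '' G.unitSphere p) (G.pSpectralRadius r p) := by
  classical
  have hE : E(G).Finite :=
    hfin.finite_subsets.subset fun e he => G.subset_vertexSet_of_mem_edgeSet' he
  have hef : ∀ e ∈ E(G), e.Finite := fun e he =>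
    hfin.subset (G.subset_vertexSet_of_mem_edgeSet' he)
  have hS : ∀ x : α → ℝ, ∑ᶠ v ∈ V(G), |x v| ^ p = ∑ v ∈ hfin.toFinset, |x v| ^ p :=
    fun x => finsum_mem_eq_finite_toFinset_sum _ hfin
  set K : Set (α → ℝ) :=
    Set.pi Set.univ (fun v => if v ∈ V(G) then Set.Icc (-1 : ℝ) 1 else {0}) ∩
      {x | ∑ v ∈ hfin.toFinset, |x v| ^ p = 1} with hK
  have hKc : IsCompact K := by
    refine (isCompact_univ_pi fun v => ?_).inter_right ?_
    · split_ifs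
      · exact isCompact_Icc
      · exact isCompact_singleton
    · refine isClosed_eq (continuous_finsetSum _ fun v _ => ?_) continuous_const
      exact (continuous_apply v).abs.rpow_const fun _ => Or.inr hp.le
  have hcont : Continuous (G.polyForm r) := by
    have h : G.polyForm r = fun x => (r : ℝ) * ∑ e ∈ hE.toFinset,
        ∏ v ∈ (if h : e ∈ E(G) then (hef e h).toFinset else ∅), x v := by
      funext x
      unfold polyForm
      rw [finsum_mem_eq_finite_toFinset_sum _ hE]
      congr 1
      refine Finset.sum_congr rfl fun e he => ?_
      have he' : e ∈ E(G) := by simpa using he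
      rw [dif_pos he', finprod_mem_eq_finite_toFinset_prod _ (hef e he')]
    rw [h]
    fun_prop
  have himg : G.polyForm r '' G.unitSphere p = G.polyForm r '' K := by
    apply Set.Subset.antisymm
    · rintro _ ⟨x, hx, rfl⟩
      have hx' : ∑ v ∈ hfin.toFinset, |x v| ^ p = 1 := by rw [← hS]; exact hx
      refine ⟨fun v => if v ∈ V(G) then x v else 0, ⟨fun v _ => ?_, ?_⟩, ?_⟩
      · by_cases hv : v ∈ V(G)
        · simp only [hv, if_true]
          have h1 : |x v| ^ p ≤ 1 := by
            rw [← hx']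
            exact Finset.single_le_sum (f := fun v => |x v| ^ p)
              (fun i _ => Real.rpow_nonneg (abs_nonneg _) _) (by simpa using hv)
          have h2 : |x v| ≤ 1 := by
            by_contra hlt
            exact absurd h1 (not_le.mpr (Real.one_lt_rpow (not_le.mp hlt) hp))
          exact abs_le.mp h2
        · simp [hv]
      · refine Eq.trans (Finset.sum_congr rfl fun v hv => ?_) hx'
        have : v ∈ V(G) := by simpa using hv
        simp [this]
      · unfold polyForm
        congr 1
        refine finsum_mem_congr rfl fun e he => finprod_mem_congr rfl fun v hv => ?_
        simp [G.subset_vertexSet_of_mem_edgeSet' he hv]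
    · exact Set.image_mono fun x hx => (hS x).trans hx.2
  have hKne : K.Nonempty := by
    obtain ⟨v₀, hv₀⟩ := hne
    refine ⟨Pi.single v₀ 1, fun v _ => ?_, ?_⟩
    · by_cases h : v = v₀
      · subst h; simp [hv₀]
      · by_cases hv : v ∈ V(G) <;> simp [h, hv]
    · have : ∀ v ∈ hfin.toFinset, v ≠ v₀ → |(Pi.single v₀ (1 : ℝ) : α → ℝ) v| ^ p = 0 := by
        intro v _ h
        simp [h, Real.zero_rpow hp.ne']
      simp only [Set.mem_ofPred_eq]
      rw [Finset.sum_eq_single_of_mem v₀ (by simpa using hv₀) this]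
      simp
  unfold pSpectralRadius
  rw [himg]
  exact (hKc.image hcont).isGreatest_sSup (hKne.image _)

end Hypergraph

namespace Hypergraph

variable {α β : Type*}

theorem edgeSet_finite {G : Hypergraph α} (hfin : V(G).Finite) : E(G).Finite :=
  hfin.finite_subsets.subset fun _ he => G.subset_vertexSet_of_mem_edgeSet' he

theorem edge_finite {G : Hypergraph α} (hfin : V(G).Finite) {e : Set α} (he : e ∈ E(G)) :
    e.Finite :=
  hfin.subset (G.subset_vertexSet_of_mem_edgeSet' he)

theorem polyForm_eq_sum {G : Hypergraph α} (hfin : V(G).Finite) (r : ℕ) (x : α → ℝ) :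
    G.polyForm r x = r * ∑ e ∈ (edgeSet_finite hfin).toFinset, ∏ᶠ v ∈ e, x v := by
  rw [polyForm, finsum_mem_eq_finite_toFinset_sum]

theorem mem_unitSphere_iff {G : Hypergraph α} (hfin : V(G).Finite) (p : ℝ) (x : α → ℝ) :
    x ∈ G.unitSphere p ↔ ∑ v ∈ hfin.toFinset, |x v| ^ p = 1 := by
  rw [← finsum_mem_eq_finite_toFinset_sum]
  rfl

section FinprodMem

variable {s : Set α} {x y : α → ℝ}

theorem finprod_mem_nonneg_of_nonneg (hx : ∀ v, 0 ≤ x v) : 0 ≤ ∏ᶠ v ∈ s, x v :=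
  finprod_nonneg fun v => finprod_nonneg fun _ => hx v

theorem finprod_mem_pos_of_pos (hs : s.Finite) (hx : ∀ v ∈ s, 0 < x v) : 0 < ∏ᶠ v ∈ s, x v := by
  rw [finprod_mem_eq_finite_toFinset_prod _ hs]
  exact Finset.prod_pos fun v hv => hx v (by simpa using hv)

theorem finprod_mem_abs (hs : s.Finite) : ∏ᶠ v ∈ s, |x v| = |∏ᶠ v ∈ s, x v| := by
  rw [finprod_mem_eq_finite_toFinset_prod _ hs, finprod_mem_eq_finite_toFinset_prod _ hs,
    Finset.abs_prod]

theorem finprod_mem_mono (hs : s.Finite) (hx : ∀ v ∈ s, 0 ≤ x v) (hxy : ∀ v ∈ s, x v ≤ y v) :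
    ∏ᶠ v ∈ s, x v ≤ ∏ᶠ v ∈ s, y v := by
  rw [finprod_mem_eq_finite_toFinset_prod _ hs, finprod_mem_eq_finite_toFinset_prod _ hs]
  exact Finset.prod_le_prod (fun v hv => hx v (by simpa using hv))
    fun v hv => hxy v (by simpa using hv)

theorem finprod_mem_const_mul (hs : s.Finite) (c : ℝ) :
    ∏ᶠ v ∈ s, c * x v = c ^ s.ncard * ∏ᶠ v ∈ s, x v := by
  rw [finprod_mem_eq_finite_toFinset_prod _ hs, finprod_mem_eq_finite_toFinset_prod _ hs,
    Finset.prod_mul_distrib, Finset.prod_const, Set.ncard_eq_toFinset_card s hs]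

theorem finprod_mem_rpow (hs : s.Finite) (hx : ∀ v, 0 ≤ x v) (t : ℝ) :
    ∏ᶠ v ∈ s, x v ^ t = (∏ᶠ v ∈ s, x v) ^ t := by
  rw [finprod_mem_eq_finite_toFinset_prod _ hs, finprod_mem_eq_finite_toFinset_prod _ hs,
    Real.finsetProd_rpow _ _ fun v _ => hx v]

theorem finprod_mem_const (hs : s.Finite) (c : ℝ) : ∏ᶠ _v ∈ s, c = c ^ s.ncard := by
  rw [finprod_mem_eq_finite_toFinset_prod _ hs, Finset.prod_const, Set.ncard_eq_toFinset_card s hs]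

theorem finprod_mem_eq_zero_of_mem (hs : s.Finite) {v : α} (hv : v ∈ s) (h : x v = 0) :
    ∏ᶠ v ∈ s, x v = 0 := by
  rw [finprod_mem_eq_finite_toFinset_prod _ hs]
  exact Finset.prod_eq_zero (i := v) (by simpa using hv) h

end FinprodMem

section SpectralRadius

variable {G : Hypergraph α} {r : ℕ} {q : ℝ}

theorem polyForm_le_pSpectralRadius (hfin : V(G).Finite) (hne : V(G).Nonempty) (hq : 0 < q)
    {x : α → ℝ} (hx : x ∈ G.unitSphere q) : G.polyForm r x ≤ G.pSpectralRadius r q :=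
  (isGreatest_pSpectralRadius G r q hfin hne hq).2 ⟨x, hx, rfl⟩

/-- The polynomial form is homogeneous of degree `r`, so that it is bounded by the spectral radius
times a power of the norm. -/
theorem polyForm_le_mul_rpow (hfin : V(G).Finite) (hne : V(G).Nonempty) (hunif : G.IsUniform r)
    (hr : r ≠ 0) (hq : 0 < q) (x : α → ℝ) :
    G.polyForm r x ≤ G.pSpectralRadius r q * (∑ v ∈ hfin.toFinset, |x v| ^ q) ^ (r / q) := by
  have hr0 : (r : ℝ) ≠ 0 := by exact_mod_cast hr
  have hnn : ∀ v ∈ hfin.toFinset, 0 ≤ |x v| ^ q := fun v _ => Real.rpow_nonneg (abs_nonneg _) _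
  set S := ∑ v ∈ hfin.toFinset, |x v| ^ q with hS
  rcases (Finset.sum_nonneg hnn).eq_or_lt with h0 | hpos
  · have hz : ∀ v ∈ V(G), x v = 0 := by
      intro v hv
      have := (Finset.sum_eq_zero_iff_of_nonneg hnn).1 h0.symm v (by simpa using hv)
      rw [Real.rpow_eq_zero (abs_nonneg _) hq.ne'] at this
      exact abs_eq_zero.1 this
    have h1 : S = 0 := h0.symm
    rw [h1, Real.zero_rpow (div_ne_zero hr0 hq.ne'), mul_zero, polyForm_eq_sum hfin,
      Finset.sum_eq_zero, mul_zero]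
    intro e he
    have he' : e ∈ E(G) := by simpa using he
    obtain ⟨v, hv⟩ : e.Nonempty := Set.nonempty_of_ncard_ne_zero (by rwa [hunif e he'])
    exact finprod_mem_eq_zero_of_mem (edge_finite hfin he') hv
      (hz v (G.subset_vertexSet_of_mem_edgeSet' he' hv))
  · replace hpos : 0 < S := hpos
    set c := S ^ (-(1 / q)) with hc
    have hc0 : 0 < c := Real.rpow_pos_of_pos hpos _
    have hcq : c ^ q = S⁻¹ := by
      rw [hc, ← Real.rpow_mul hpos.le, ← Real.rpow_neg_one]
      congr 1
      field_simp
    have hcr : c ^ r * S ^ (r / q) = 1 := by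
      rw [hc, ← Real.rpow_natCast, ← Real.rpow_mul hpos.le, ← Real.rpow_add hpos]
      rw [show -(1 / q) * r + r / q = 0 by ring, Real.rpow_zero]
    have hmem : (fun v => c * x v) ∈ G.unitSphere q := by
      rw [mem_unitSphere_iff hfin]
      have : ∀ v ∈ hfin.toFinset, |c * x v| ^ q = S⁻¹ * |x v| ^ q := by
        intro v _
        rw [abs_mul, abs_of_pos hc0, Real.mul_rpow hc0.le (abs_nonneg _), hcq]
      rw [Finset.sum_congr rfl this, ← Finset.mul_sum, inv_mul_cancel₀ hpos.ne']
    have hle := polyForm_le_pSpectralRadius (r := r) hfin hne hq hmem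
    have hhom : G.polyForm r (fun v => c * x v) = c ^ r * G.polyForm r x := by
      rw [polyForm_eq_sum hfin, polyForm_eq_sum hfin, mul_left_comm]
      congr 1
      rw [Finset.mul_sum]
      refine Finset.sum_congr rfl fun e he => ?_
      have he' : e ∈ E(G) := by simpa using he
      rw [finprod_mem_const_mul (edge_finite hfin he'), hunif e he']
    rw [hhom] at hle
    calc G.polyForm r x = (c ^ r * G.polyForm r x) * S ^ (r / q) := by
          linear_combination -(G.polyForm r x) * hcr
      _ ≤ _ := mul_le_mul_of_nonneg_right hle (Real.rpow_nonneg hpos.le _)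

theorem exists_nonneg_polyForm_eq (hfin : V(G).Finite) (hne : V(G).Nonempty) (hq : 0 < q) (r : ℕ) :
    ∃ x : α → ℝ, (∀ v, 0 ≤ x v) ∧ ∑ v ∈ hfin.toFinset, x v ^ q = 1 ∧
      G.polyForm r x = G.pSpectralRadius r q := by
  obtain ⟨x, hx, hxe⟩ := (isGreatest_pSpectralRadius G r q hfin hne hq).1
  have hx' := (mem_unitSphere_iff hfin q x).1 hx
  refine ⟨fun v => |x v|, fun v => abs_nonneg _, hx', le_antisymm ?_ ?_⟩
  · exact polyForm_le_pSpectralRadius hfin hne hq ((mem_unitSphere_iff hfin q _).2 (by simpa using hx'))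
  · rw [← hxe, polyForm_eq_sum hfin, polyForm_eq_sum hfin]
    refine mul_le_mul_of_nonneg_left (Finset.sum_le_sum fun e he => ?_) r.cast_nonneg
    rw [finprod_mem_abs (edge_finite hfin (by simpa using he))]
    exact le_abs_self _

theorem polyForm_nonneg (hfin : V(G).Finite) {x : α → ℝ} (hx : ∀ v, 0 ≤ x v) :
    0 ≤ G.polyForm r x := by
  rw [polyForm_eq_sum hfin]
  exact mul_nonneg r.cast_nonneg (Finset.sum_nonneg fun e _ => finprod_mem_nonneg_of_nonneg hx)

/-- If `q > r`, a nonnegative maximizer is positive on every edge. -/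
theorem pos_of_polyForm_eq (hfin : V(G).Finite) (hne : V(G).Nonempty) (hunif : G.IsUniform r)
    (hr : r ≠ 0) (hq : (r : ℝ) < q) {x : α → ℝ} (hx : ∀ v, 0 ≤ x v)
    (hx1 : ∑ v ∈ hfin.toFinset, x v ^ q = 1) (hxe : G.polyForm r x = G.pSpectralRadius r q)
    {e : Set α} (he : e ∈ E(G)) {v : α} (hv : v ∈ e) : 0 < x v := by
  classical
  by_contra hnot
  have hv0 : x v = 0 := le_antisymm (not_lt.1 hnot) (hx v)
  have hrpos : (0 : ℝ) < r := by exact_mod_cast Nat.pos_of_ne_zero hr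
  have hq0 : 0 < q := hrpos.trans hq
  set l := G.pSpectralRadius r q with hl
  have hl0 : 0 ≤ l := hxe ▸ polyForm_nonneg hfin hx
  have hef := edge_finite hfin he
  set ε : ℝ := (l + 1) ^ (-(1 / (q - r))) with hε
  have hε0 : 0 < ε := Real.rpow_pos_of_pos (by linarith) _
  set y : α → ℝ := fun v => if v ∈ e then max (x v) ε else x v with hy
  have hxy : ∀ v, x v ≤ y v := fun v => by
    simp only [hy]; split_ifs
    · exact le_max_left _ _
    · exact le_rfl
  have hy0 : ∀ v, 0 ≤ y v := fun v => (hx v).trans (hxy v)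
  have hgain : l + r * ε ^ r ≤ G.polyForm r y := by
    rw [← hxe, polyForm_eq_sum hfin, polyForm_eq_sum hfin, ← mul_add]
    refine mul_le_mul_of_nonneg_left ?_ hrpos.le
    have hmem : e ∈ (edgeSet_finite hfin).toFinset := by simpa using he
    rw [← Finset.add_sum_erase _ _ hmem, ← Finset.add_sum_erase _ _ hmem,
      finprod_mem_eq_zero_of_mem hef hv hv0, zero_add, add_comm]
    refine add_le_add ?_ (Finset.sum_le_sum fun e' he' => finprod_mem_mono
      (edge_finite hfin (by simpa using Finset.mem_of_mem_erase he')) (fun v _ => hx v)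
      fun v _ => hxy v)
    rw [← hunif e he, ← finprod_mem_const hef]
    refine finprod_mem_mono hef (fun v _ => hε0.le) fun v hv => ?_
    simp [hy, hv]
  have hcost : ∑ v ∈ hfin.toFinset, |y v| ^ q ≤ 1 + r * ε ^ q := by
    have h1 : ∀ v ∈ hfin.toFinset, |y v| ^ q ≤ x v ^ q + if v ∈ e then ε ^ q else 0 := by
      intro v _
      rw [abs_of_nonneg (hy0 v)]
      by_cases h : v ∈ e
      · simp only [hy, h, if_true]
        rcases max_choice (x v) ε with h | h <;> rw [h]
        · linarith [Real.rpow_nonneg hε0.le q]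
        · linarith [Real.rpow_nonneg (hx v) q]
      · simp [hy, h]
    refine (Finset.sum_le_sum h1).trans ?_
    rw [Finset.sum_add_distrib, hx1, ← Finset.sum_filter, Finset.sum_const, nsmul_eq_mul,
      ← hunif e he, Set.ncard_eq_toFinset_card e hef]
    gcongr
    intro v hv
    simpa using (Finset.mem_filter.1 hv).2
  have hone : (1 : ℝ) ≤ 1 + r * ε ^ q := by
    linarith [mul_nonneg hrpos.le (Real.rpow_nonneg hε0.le q)]
  have hpow : (∑ v ∈ hfin.toFinset, |y v| ^ q) ^ (r / q) ≤ 1 + r * ε ^ q :=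
    calc _ ≤ (1 + r * ε ^ q) ^ (r / q) := by
          refine Real.rpow_le_rpow (Finset.sum_nonneg fun v _ => ?_) hcost (by positivity)
          exact Real.rpow_nonneg (abs_nonneg _) _
      _ ≤ (1 + r * ε ^ q) ^ (1 : ℝ) :=
          Real.rpow_le_rpow_of_exponent_le hone ((div_le_one hq0).2 hq.le)
      _ = _ := Real.rpow_one _
  have hle := hgain.trans ((polyForm_le_mul_rpow hfin hne hunif hr hq0 y).trans
    (mul_le_mul_of_nonneg_left hpow hl0))
  have h2 : r * ε ^ r ≤ r * (l * ε ^ q) := by nlinarith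
  have h3 : ε ^ r ≤ l * ε ^ q := le_of_mul_le_mul_left h2 hrpos
  have h4 : ε ^ q = ε ^ r * (l + 1)⁻¹ := by
    rw [← Real.rpow_natCast ε r, ← Real.rpow_neg_one,
      show (l + 1) ^ (-1 : ℝ) = ε ^ (q - r) by
        rw [hε, ← Real.rpow_mul (by linarith)]
        congr 1
        have : q - r ≠ 0 := by linarith
        field_simp, ← Real.rpow_add hε0]
    congr 1
    ring
  have h5 : 0 < ε ^ r := by positivity
  rw [h4, ← div_eq_mul_inv, ← mul_div_assoc, le_div_iff₀ (by linarith)] at h3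
  nlinarith

end SpectralRadius

section Constants

/-- The maximum `r ^ r / (r + 1) ^ (r + 1)` of `b * a ^ r` over `a, b ≥ 0` with `a + b = 1`. -/
noncomputable def splitMax (r : ℕ) : ℝ := (r : ℝ) ^ r / ((r : ℝ) + 1) ^ (r + 1)

theorem splitMax_pos {r : ℕ} (hr : r ≠ 0) : 0 < splitMax r := by
  have : (0 : ℝ) < r := by exact_mod_cast Nat.pos_of_ne_zero hr
  unfold splitMax
  positivity

theorem mul_pow_le_splitMax {r : ℕ} (hr : r ≠ 0) {a b : ℝ} (ha : 0 ≤ a) (hb : 0 ≤ b)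
    (hab : a + b = 1) : b * a ^ r ≤ splitMax r := by
  have hr0 : (0 : ℝ) < r := by exact_mod_cast Nat.pos_of_ne_zero hr
  have hr1 : (0 : ℝ) < (r : ℝ) + 1 := by linarith
  have hB : 0 ≤ (r + 1) * b := by positivity
  have hA : 0 ≤ (r + 1) * a / r := by positivity
  have h := Real.geom_mean_le_arith_mean2_weighted (w₁ := 1 / ((r : ℝ) + 1))
    (w₂ := r / ((r : ℝ) + 1)) (by positivity) (by positivity) hB hA (by field_simp; ring)
  have h1 : 1 / ((r : ℝ) + 1) * ((r + 1) * b) + r / ((r : ℝ) + 1) * ((r + 1) * a / r) = 1 := by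
    field_simp
    linarith
  rw [h1] at h
  have h2 := pow_le_one₀ (n := r + 1) (by positivity) h
  rw [mul_pow, ← Real.rpow_mul_natCast hB, ← Real.rpow_mul_natCast hA] at h2
  push_cast at h2
  rw [one_div_mul_cancel hr1.ne', Real.rpow_one, div_mul_cancel₀ _ hr1.ne', Real.rpow_natCast,
    div_pow, mul_pow, mul_div_assoc', div_le_one (by positivity)] at h2
  rw [splitMax, le_div_iff₀ (by positivity)]
  calc b * a ^ r * (r + 1) ^ (r + 1) = (r + 1) * b * ((r + 1) ^ r * a ^ r) := by ring
    _ ≤ _ := h2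

theorem rpow_mul_rpow_le_splitMax {r : ℕ} (hr : r ≠ 0) {q : ℝ} (hq : 0 < q) {a b : ℝ} (ha : 0 ≤ a)
    (hb : 0 ≤ b) (hab : a + b = 1) :
    b ^ (1 / q) * a ^ ((r : ℝ) / q) ≤ splitMax r ^ (1 / q) := by
  rw [show (r : ℝ) / q = r * (1 / q) by ring, Real.rpow_mul ha, Real.rpow_natCast,
    ← Real.mul_rpow hb (by positivity)]
  exact Real.rpow_le_rpow (by positivity) (mul_pow_le_splitMax hr ha hb hab) (by positivity)

theorem div_mul_splitMax_rpow {r : ℕ} (hr : r ≠ 0) {p : ℝ} (hp : (r : ℝ) < p) :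
    ((r : ℝ) + 1) / r * splitMax r ^ (1 / (p + 1)) =
      (((r : ℝ) + 1) ^ (p - r) / (r : ℝ) ^ (p + 1 - r)) ^ (1 / (p + 1)) := by
  have hr0 : (0 : ℝ) < r := by exact_mod_cast Nat.pos_of_ne_zero hr
  have hr1 : (0 : ℝ) < (r : ℝ) + 1 := by linarith
  have hq : p + 1 ≠ 0 := by linarith
  have h : ((r : ℝ) + 1) / r = ((((r : ℝ) + 1) / r) ^ (p + 1)) ^ (1 / (p + 1)) := by
    rw [← Real.rpow_mul (by positivity), mul_one_div_cancel hq, Real.rpow_one]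
  rw [h, ← Real.mul_rpow (by positivity) (splitMax_pos hr).le]
  congr 1
  rw [splitMax, Real.div_rpow hr1.le hr0.le, ← Real.rpow_natCast, ← Real.rpow_natCast,
    show p - r = (p + 1) - (r + 1 : ℕ) by push_cast; ring, Real.rpow_sub hr1, Real.rpow_sub hr0]
  field_simp

theorem mul_splitMax_rpow_mul {r : ℕ} (hr : r ≠ 0) {p l : ℝ} (hp : (r : ℝ) < p) (hl : 0 ≤ l) :
    ((r : ℝ) + 1) * splitMax r ^ (1 / (p + 1)) * (l / r) ^ (p / (p + 1)) =
      ((((r : ℝ) + 1) / r) ^ (p - r) * l ^ p) ^ (1 / (p + 1)) := by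
  have hr0 : (0 : ℝ) < r := by exact_mod_cast Nat.pos_of_ne_zero hr
  have hr1 : (0 : ℝ) < (r : ℝ) + 1 := by linarith
  have hq : p + 1 ≠ 0 := by linarith
  have h : ((r : ℝ) + 1) = (((r : ℝ) + 1) ^ (p + 1)) ^ (1 / (p + 1)) := by
    rw [← Real.rpow_mul (by positivity), mul_one_div_cancel hq, Real.rpow_one]
  have hK := (splitMax_pos hr).le
  rw [div_eq_mul_one_div p, Real.rpow_mul (by positivity)]
  nth_rw 1 [h]
  rw [← Real.mul_rpow (by positivity) hK, ← Real.mul_rpow (by positivity) (by positivity)]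
  congr 1
  rw [splitMax, Real.div_rpow hr1.le hr0.le, Real.div_rpow hl hr0.le, ← Real.rpow_natCast,
    ← Real.rpow_natCast,
    show p + 1 = (p - r) + (r + 1 : ℕ) by push_cast; ring, Real.rpow_add hr1, Real.rpow_sub hr0]
  field_simp

end Constants

section Isomorphic

theorem isomorphic_of_image {G : Hypergraph β} {ψ : β → α} (hψ : Set.InjOn ψ V(G)) :
    (G.image ψ).Isomorphic G := by
  have hbij : Set.BijOn ψ V(G) V(G.image ψ) := ⟨Set.mapsTo_image _ _, hψ, Set.surjOn_image _ _⟩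
  refine ⟨(hbij.equiv ψ).symm, fun S => ?_⟩
  set T : Set V(G) := (hbij.equiv ψ).symm '' S with hT
  have hS : Subtype.val '' S = ψ '' (Subtype.val '' T) := by
    rw [hT, Set.image_image, Set.image_image]
    refine Set.image_congr fun v _ => ?_
    exact (congrArg Subtype.val ((hbij.equiv ψ).apply_symm_apply v)).symm
  have hTV : Subtype.val '' T ⊆ V(G) := by
    rintro _ ⟨v, -, rfl⟩
    exact v.2
  rw [hS, mem_edgeSet_image]
  constructor
  · rintro ⟨e, he, heT⟩
    rwa [← (hψ.image_eq_image_iff he.subset_vertexSet hTV).1 heT]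
  · exact fun h => ⟨_, h, rfl⟩

theorem Isomorphic.ncard_vertexSet_eq {G : Hypergraph α} {H : Hypergraph β} (h : G.Isomorphic H) :
    V(G).ncard = V(H).ncard := by
  obtain ⟨φ, -⟩ := h
  exact Nat.card_congr φ

end Isomorphic

section Extension

variable {G H : Hypergraph α} {f : Set α → α}

theorem not_mem_edge (hf : ∀ e ∈ E(G), f e ∉ V(G)) {e : Set α} (he : e ∈ E(G)) : f e ∉ e :=
  fun h => hf e he (he.subset_vertexSet h)

theorem insert_injOn (hf : ∀ e ∈ E(G), f e ∉ V(G)) :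
    Set.InjOn (fun e => insert (f e) e) E(G) := by
  have key : ∀ e ∈ E(G), insert (f e) e ∩ V(G) = e := by
    intro e he
    rw [Set.insert_inter_of_notMem (hf e he), Set.inter_eq_left]
    exact he.subset_vertexSet
  intro e he e' he' h
  rw [← key e he, ← key e' he']
  exact congrArg (· ∩ V(G)) h

theorem disjoint_image_vertexSet (hf : ∀ e ∈ E(G), f e ∉ V(G)) : Disjoint V(G) (f '' E(G)) := by
  rw [Set.disjoint_right]
  rintro _ ⟨e, he, rfl⟩
  exact hf e he

theorem ncard_vertexSet_of_extension (hfin : V(G).Finite) (hf : ∀ e ∈ E(G), f e ∉ V(G))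
    (hV : V(H) = V(G) ∪ f '' E(G)) : V(H).ncard = V(G).ncard + (f '' E(G)).ncard := by
  rw [hV, Set.ncard_union_eq (disjoint_image_vertexSet hf) hfin ((edgeSet_finite hfin).image f)]

theorem ncard_inl_union_inr {s : Set α} {t : Set β} (hs : s.Finite) (ht : t.Finite) :
    (Sum.inl '' s ∪ Sum.inr '' t : Set (α ⊕ β)).ncard = s.ncard + t.ncard := by
  rw [Set.ncard_union_eq _ (hs.image _) (ht.image _), Set.ncard_image_of_injective _ Sum.inl_injective,
    Set.ncard_image_of_injective _ Sum.inr_injective]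
  rw [Set.disjoint_left]
  rintro _ ⟨a, -, rfl⟩ ⟨b, -, h⟩
  cases h

theorem isomorphic_generalizedPower_iff (hfin : V(G).Finite) (hf : ∀ e ∈ E(G), f e ∉ V(G))
    (hV : V(H) = V(G) ∪ f '' E(G)) (hE : E(H) = (fun e => insert (f e) e) '' E(G)) :
    H.Isomorphic G.generalizedPower ↔ Set.InjOn f E(G) := by
  constructor
  · intro h
    have h1 := h.ncard_vertexSet_eq
    rw [ncard_vertexSet_of_extension hfin hf hV, generalizedPower,
      ncard_inl_union_inr hfin (edgeSet_finite hfin)] at h1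
    exact (Set.ncard_image_iff (edgeSet_finite hfin)).1 (Nat.add_left_cancel h1)
  · intro hinj
    have hH : H = G.generalizedPower.image (Sum.elim id f) := by
      ext1
      · simp [generalizedPower, hV, Set.image_union, Set.image_image]
      · simp [generalizedPower, hE, Set.image_image, Set.image_insert_eq]
    rw [hH]
    apply isomorphic_of_image
    rintro _ (⟨v, hv, rfl⟩ | ⟨e, he, rfl⟩) _ (⟨w, hw, rfl⟩ | ⟨e', he', rfl⟩) h
    · exact congrArg _ h
    · exact absurd (show v ∈ V(G) from hv) (by rw [show v = f e' from h]; exact hf e' he')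
    · exact absurd (show w ∈ V(G) from hw) (by rw [← show f e = w from h]; exact hf e he)
    · exact congrArg _ (hinj he he' h)

theorem isomorphic_starProduct_kOne_iff (hfin : V(G).Finite) (hf : ∀ e ∈ E(G), f e ∉ V(G))
    (hV : V(H) = V(G) ∪ f '' E(G)) (hE : E(H) = (fun e => insert (f e) e) '' E(G)) :
    H.Isomorphic (G.starProduct kOne) ↔ ∃ w, f '' E(G) = {w} := by
  constructor
  · intro h
    have h1 := h.ncard_vertexSet_eq
    rw [ncard_vertexSet_of_extension hfin hf hV, starProduct,
      ncard_inl_union_inr hfin (Set.toFinite _)] at h1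
    have h2 := Nat.add_left_cancel h1
    rw [kOne, Set.ncard_univ, Nat.card_unique, Set.ncard_eq_one] at h2
    exact h2
  · rintro ⟨w, hw⟩
    have hfw : ∀ e ∈ E(G), f e = w := fun e he => by
      simpa [hw] using Set.mem_image_of_mem f he
    have hwV : w ∉ V(G) := by
      obtain ⟨e, he, rfl⟩ : w ∈ f '' E(G) := by simp [hw]
      exact hf e he
    have hH : H = (G.starProduct kOne).image (Sum.elim id fun _ => w) := by
      ext1
      · ext v
        simp [starProduct, kOne, hV, hw, or_comm, eq_comm]
      · ext s
        simp only [hE, Set.mem_image, mem_edgeSet_image]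
        constructor
        · rintro ⟨e, he, rfl⟩
          refine ⟨_, ⟨e, he, _, rfl, rfl⟩, ?_⟩
          ext v
          simp [hfw e he, or_comm, eq_comm]
        · rintro ⟨_, ⟨e, he, _, rfl, rfl⟩, rfl⟩
          refine ⟨e, he, ?_⟩
          ext v
          simp [hfw e he, or_comm, eq_comm]
    rw [hH]
    apply isomorphic_of_image
    rintro _ (⟨v, hv, rfl⟩ | ⟨e, he, rfl⟩) _ (⟨v', hv', rfl⟩ | ⟨e', he', rfl⟩) h
    · exact congrArg _ h
    · exact absurd (show v ∈ V(G) from hv) (by rw [show v = w from h]; exact hwV)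
    · exact absurd (show v' ∈ V(G) from hv') (by rw [← show w = v' from h]; exact hwV)
    · rfl

theorem isUniform_of_extension {r : ℕ} (hfin : V(G).Finite) (hunif : G.IsUniform r)
    (hf : ∀ e ∈ E(G), f e ∉ V(G)) (hE : E(H) = (fun e => insert (f e) e) '' E(G)) :
    H.IsUniform (r + 1) := by
  intro e' he'
  rw [hE] at he'
  obtain ⟨e, he, rfl⟩ := he'
  show (insert (f e) e).ncard = r + 1
  rw [Set.ncard_insert_of_notMem (not_mem_edge hf he) (edge_finite hfin he), hunif e he]

theorem finite_vertexSet_of_extension (hfin : V(G).Finite) (hV : V(H) = V(G) ∪ f '' E(G)) :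
    V(H).Finite :=
  hV ▸ hfin.union ((edgeSet_finite hfin).image f)

theorem polyForm_of_extension (hfin : V(G).Finite) (hf : ∀ e ∈ E(G), f e ∉ V(G))
    (hE : E(H) = (fun e => insert (f e) e) '' E(G)) (r : ℕ) (x : α → ℝ) :
    H.polyForm (r + 1) x =
      (r + 1) * ∑ e ∈ (edgeSet_finite hfin).toFinset, x (f e) * ∏ᶠ v ∈ e, x v := by
  rw [polyForm, hE, finsum_mem_image (insert_injOn hf),
    finsum_mem_eq_finite_toFinset_sum _ (edgeSet_finite hfin)]
  push_cast
  congr 1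
  refine Finset.sum_congr rfl fun e he => ?_
  have he' : e ∈ E(G) := by simpa using he
  exact finprod_mem_insert _ (not_mem_edge hf he') (edge_finite hfin he')

theorem sum_vertexSet_of_extension (hfin : V(G).Finite) (hf : ∀ e ∈ E(G), f e ∉ V(G))
    (hV : V(H) = V(G) ∪ f '' E(G)) (hHfin : V(H).Finite) (x : α → ℝ) :
    ∑ v ∈ hHfin.toFinset, x v =
      ∑ v ∈ hfin.toFinset, x v + ∑ w ∈ ((edgeSet_finite hfin).image f).toFinset, x w := by
  rw [← finsum_mem_eq_finite_toFinset_sum, ← finsum_mem_eq_finite_toFinset_sum,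
    ← finsum_mem_eq_finite_toFinset_sum, hV,
    finsum_mem_union (disjoint_image_vertexSet hf) hfin ((edgeSet_finite hfin).image f)]

end Extension

section Bounds

variable {G H : Hypergraph α} {f : Set α → α} {r : ℕ}

theorem nonempty_vertexSet_of_extension (hne : V(G).Nonempty) (hV : V(H) = V(G) ∪ f '' E(G)) :
    V(H).Nonempty :=
  hV ▸ hne.inl

/-- Lower bound for the spectral radius of an extension from a unit vector `u` on `V(G)` and a
vector `g` on the new vertices, which are glued with the optimal weights. -/
theorem le_pSpectralRadius_of_extension (hfin : V(G).Finite) (hne : V(G).Nonempty)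
    (hunif : G.IsUniform r) (hr : r ≠ 0) (hf : ∀ e ∈ E(G), f e ∉ V(G))
    (hV : V(H) = V(G) ∪ f '' E(G)) (hE : E(H) = (fun e => insert (f e) e) '' E(G))
    {q : ℝ} (hq : 0 < q) {u g : α → ℝ} (hu : ∀ v, 0 ≤ u v) (hg : ∀ v, 0 ≤ g v)
    (hu1 : ∑ v ∈ hfin.toFinset, u v ^ q = 1) {T : ℝ} (hT : 0 < T)
    (hgT : ∑ w ∈ ((edgeSet_finite hfin).image f).toFinset, g w ^ q = T) :
    ((r : ℝ) + 1) * splitMax r ^ (1 / q) * T ^ (-(1 / q)) *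
        ∑ e ∈ (edgeSet_finite hfin).toFinset, g (f e) * ∏ᶠ v ∈ e, u v ≤
      H.pSpectralRadius (r + 1) q := by
  classical
  have hr0 : (0 : ℝ) < r := by exact_mod_cast Nat.pos_of_ne_zero hr
  have hr1 : (0 : ℝ) < (r : ℝ) + 1 := by linarith
  have hHfin := finite_vertexSet_of_extension hfin hV
  set a : ℝ := (r / ((r : ℝ) + 1)) ^ (1 / q) with ha
  set b : ℝ := (1 / (((r : ℝ) + 1) * T)) ^ (1 / q) with hb
  have ha0 : 0 ≤ a := by positivity
  have hb0 : 0 ≤ b := by positivity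
  have haq : a ^ q = r / ((r : ℝ) + 1) := by
    rw [ha, ← Real.rpow_mul (by positivity), one_div_mul_cancel hq.ne', Real.rpow_one]
  have hbq : b ^ q = 1 / (((r : ℝ) + 1) * T) := by
    rw [hb, ← Real.rpow_mul (by positivity), one_div_mul_cancel hq.ne', Real.rpow_one]
  have hab : b * a ^ r = splitMax r ^ (1 / q) * T ^ (-(1 / q)) := by
    rw [ha, ← Real.rpow_mul_natCast (by positivity), mul_comm (1 / q) (r : ℝ),
      Real.rpow_mul (by positivity), Real.rpow_natCast, hb,
      ← Real.mul_rpow (by positivity) (by positivity), Real.rpow_neg hT.le, ← Real.inv_rpow hT.le,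
      ← Real.mul_rpow (splitMax_pos hr).le (by positivity), splitMax,
      div_pow]
    congr 1
    field_simp
    ring
  set h : α → ℝ := fun v => if v ∈ V(G) then a * u v else b * g v with hh
  have hh0 : ∀ v, 0 ≤ h v := fun v => by
    simp only [hh]
    split_ifs
    · exact mul_nonneg ha0 (hu v)
    · exact mul_nonneg hb0 (hg v)
  have hmem : h ∈ H.unitSphere q := by
    rw [mem_unitSphere_iff hHfin, sum_vertexSet_of_extension hfin hf hV hHfin]
    have h1 : ∀ v ∈ hfin.toFinset, |h v| ^ q = r / ((r : ℝ) + 1) * u v ^ q := by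
      intro v hv
      have hv' : v ∈ V(G) := by simpa using hv
      rw [abs_of_nonneg (hh0 v), ← haq, ← Real.mul_rpow ha0 (hu v)]
      simp [hh, hv']
    have h2 : ∀ w ∈ ((edgeSet_finite hfin).image f).toFinset,
        |h w| ^ q = 1 / (((r : ℝ) + 1) * T) * g w ^ q := by
      intro w hw
      have hw' : w ∉ V(G) :=
        Set.disjoint_right.1 (disjoint_image_vertexSet hf) ((Set.Finite.mem_toFinset _).1 hw)
      rw [abs_of_nonneg (hh0 w), ← hbq, ← Real.mul_rpow hb0 (hg w)]
      simp [hh, hw']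
    rw [Finset.sum_congr rfl h1, Finset.sum_congr rfl h2, ← Finset.mul_sum, ← Finset.mul_sum, hu1,
      hgT]
    field_simp
  refine le_trans (le_of_eq ?_) (polyForm_le_pSpectralRadius hHfin
    (nonempty_vertexSet_of_extension hne hV) hq hmem)
  rw [polyForm_of_extension hfin hf hE, mul_assoc, mul_assoc, ← mul_assoc (splitMax r ^ _), ← hab,
    Finset.mul_sum]
  congr 1
  refine Finset.sum_congr rfl fun e he => ?_
  have he' : e ∈ E(G) := by simpa using he
  have h1 : ∏ᶠ v ∈ e, h v = a ^ r * ∏ᶠ v ∈ e, u v := by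
    rw [← hunif e he', ← finprod_mem_const_mul (edge_finite hfin he')]
    refine finprod_mem_congr rfl fun v hv => ?_
    simp [hh, he'.subset_vertexSet hv]
  have h2 : h (f e) = b * g (f e) := by simp [hh, hf e he']
  rw [h1, h2]
  ring

theorem sum_edges_eq_div (hfin : V(G).Finite) (hr : r ≠ 0) (x : α → ℝ) :
    ∑ e ∈ (edgeSet_finite hfin).toFinset, ∏ᶠ v ∈ e, x v = G.polyForm r x / r := by
  have hr0 : (r : ℝ) ≠ 0 := by exact_mod_cast hr
  rw [polyForm_eq_sum hfin, mul_div_cancel_left₀ _ hr0]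

theorem lower_bound_of_extension (hfin : V(G).Finite) (hne : V(G).Nonempty)
    (hEne : E(G).Nonempty)
    (hunif : G.IsUniform r) (hr : r ≠ 0) (hf : ∀ e ∈ E(G), f e ∉ V(G))
    (hV : V(H) = V(G) ∪ f '' E(G)) (hE : E(H) = (fun e => insert (f e) e) '' E(G))
    {p : ℝ} (hp : (r : ℝ) < p) :
    ((((r : ℝ) + 1) / r) ^ (p - r) * G.pSpectralRadius r p ^ p) ^ (1 / (p + 1)) ≤
        H.pSpectralRadius (r + 1) (p + 1) ∧
      (¬ Set.InjOn f E(G) →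
        ((((r : ℝ) + 1) / r) ^ (p - r) * G.pSpectralRadius r p ^ p) ^ (1 / (p + 1)) <
          H.pSpectralRadius (r + 1) (p + 1)) := by
  classical
  have hr0 : (0 : ℝ) < r := by exact_mod_cast Nat.pos_of_ne_zero hr
  have hp0 : 0 < p := hr0.trans hp
  have hq0 : 0 < p + 1 := by linarith
  obtain ⟨z, hz0, hz1, hze⟩ := exists_nonneg_polyForm_eq hfin hne hp0 r
  set l := G.pSpectralRadius r p with hl
  set T := l / r with hTdef
  set F := (edgeSet_finite hfin).toFinset with hF
  set c : Set α → ℝ := fun e => ∏ᶠ v ∈ e, z v with hc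
  have hcpos : ∀ e ∈ F, 0 < c e := fun e he => by
    have he' : e ∈ E(G) := by simpa [hF] using he
    exact finprod_mem_pos_of_pos (edge_finite hfin he') fun v hv =>
      pos_of_polyForm_eq hfin hne hunif hr hp hz0 hz1 hze he' hv
  have hcT : ∑ e ∈ F, c e = T := by rw [hF, sum_edges_eq_div hfin hr, hze]
  have hT : 0 < T := by
    rw [← hcT]
    refine Finset.sum_pos hcpos ?_
    obtain ⟨e, he⟩ := hEne
    exact ⟨e, by simpa [hF] using he⟩
  have hl0 : 0 < l := by
    have : l = T * r := by rw [hTdef]; field_simp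
    rw [this]; positivity
  set B : α → ℝ := fun w => ∑ e ∈ F with f e = w, c e with hB
  have hB0 : ∀ w, 0 ≤ B w := fun w =>
    Finset.sum_nonneg fun e he => (hcpos e (Finset.mem_of_mem_filter e he)).le
  have hBsum : ∑ w ∈ ((edgeSet_finite hfin).image f).toFinset, (B w ^ (1 / (p + 1))) ^ (p + 1)
      = T := by
    rw [← hcT, ← Finset.sum_fiberwise_of_maps_to
      (t := ((edgeSet_finite hfin).image f).toFinset) (g := f)]
    · refine Finset.sum_congr rfl fun w _ => ?_
      rw [← Real.rpow_mul (hB0 w), one_div_mul_cancel hq0.ne', Real.rpow_one]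
    · intro e he
      rw [Set.Finite.mem_toFinset]
      exact Set.mem_image_of_mem f (by simpa [hF] using he)
  have hlow := le_pSpectralRadius_of_extension hfin hne hunif hr hf hV hE hq0
    (u := fun v => z v ^ (p / (p + 1))) (g := fun w => B w ^ (1 / (p + 1)))
    (fun v => Real.rpow_nonneg (hz0 v) _) (fun w => Real.rpow_nonneg (hB0 w) _)
    (by
      refine Eq.trans (Finset.sum_congr rfl fun v _ => ?_) hz1
      rw [← Real.rpow_mul (hz0 v), div_mul_cancel₀ _ hq0.ne']) hT hBsum
  rw [← hF] at hlow
  have hle : ∀ e ∈ F, c e ≤ B (f e) := fun e he =>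
    Finset.single_le_sum (f := c) (fun e' he' => (hcpos e' (Finset.mem_of_mem_filter e' he')).le)
      (by simp [he])
  have hterm : ∀ e ∈ F, B (f e) ^ (1 / (p + 1)) * ∏ᶠ v ∈ e, z v ^ (p / (p + 1)) =
      B (f e) ^ (1 / (p + 1)) * c e ^ (p / (p + 1)) := fun e he => by
    rw [finprod_mem_rpow (edge_finite hfin (by simpa [hF] using he)) hz0]
  rw [Finset.sum_congr rfl hterm] at hlow
  have hsplit : ∀ e ∈ F, c e = c e ^ (1 / (p + 1)) * c e ^ (p / (p + 1)) := fun e he => by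
    rw [← Real.rpow_add (hcpos e he), ← add_div, add_comm, div_self hq0.ne', Real.rpow_one]
  have hterm_le : ∀ e ∈ F, c e ≤ B (f e) ^ (1 / (p + 1)) * c e ^ (p / (p + 1)) := fun e he => by
    nth_rw 1 [hsplit e he]
    exact mul_le_mul_of_nonneg_right
      (Real.rpow_le_rpow (hcpos e he).le (hle e he) (by positivity))
      (Real.rpow_nonneg (hcpos e he).le _)
  set M := ((r : ℝ) + 1) * splitMax r ^ (1 / (p + 1)) * T ^ (-(1 / (p + 1))) with hM
  have hM0 : 0 < M := by
    have := splitMax_pos hr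
    positivity
  have hLHS : ((((r : ℝ) + 1) / r) ^ (p - r) * l ^ p) ^ (1 / (p + 1)) = M * T := by
    rw [← mul_splitMax_rpow_mul hr hp hl0.le, ← hTdef, hM, mul_assoc _ _ T]
    congr 1
    nth_rw 3 [← Real.rpow_one T]
    rw [← Real.rpow_add hT]
    congr 1
    field_simp
    ring
  rw [hLHS]
  refine ⟨le_trans ?_ hlow, fun hninj => lt_of_lt_of_le ?_ hlow⟩
  · rw [← hcT]
    exact mul_le_mul_of_nonneg_left (Finset.sum_le_sum hterm_le) hM0.le
  · rw [← hcT]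
    refine mul_lt_mul_of_pos_left (Finset.sum_lt_sum hterm_le ?_) hM0
    simp only [Set.InjOn, not_forall] at hninj
    obtain ⟨e₁, he₁, e₂, he₂, hfe, hne'⟩ := hninj
    have h₁ : e₁ ∈ F := by simpa [hF] using he₁
    have h₂ : e₂ ∈ F := by simpa [hF] using he₂
    refine ⟨e₁, h₁, ?_⟩
    have hlt : c e₁ < B (f e₁) := by
      have hsub : ({e₁, e₂} : Finset (Set α)) ⊆ F.filter fun e => f e = f e₁ := by
        intro e he
        rcases Finset.mem_insert.1 he with rfl | he
        · simp [h₁]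
        · rw [Finset.mem_singleton.1 he]
          simp [h₂, hfe]
      have := Finset.sum_le_sum_of_subset_of_nonneg (f := c) hsub
        fun e he _ => (hcpos e (Finset.mem_of_mem_filter e he)).le
      rw [Finset.sum_pair hne'] at this
      exact (lt_add_of_pos_right _ (hcpos e₂ h₂)).trans_le this
    nth_rw 1 [hsplit e₁ h₁]
    exact mul_lt_mul_of_pos_right (Real.rpow_lt_rpow (hcpos e₁ h₁).le hlt (by positivity))
      (Real.rpow_pos_of_pos (hcpos e₁ h₁) _)

theorem pSpectralRadius_nonneg {q : ℝ} (hfin : V(G).Finite) (hne : V(G).Nonempty) (hq : 0 < q) :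
    0 ≤ G.pSpectralRadius r q := by
  obtain ⟨x, hx, -, hxe⟩ := exists_nonneg_polyForm_eq hfin hne hq r
  exact hxe ▸ polyForm_nonneg hfin hx

theorem le_lower_bound_of_injOn (hfin : V(G).Finite) (hne : V(G).Nonempty)
    (hunif : G.IsUniform r) (hr : r ≠ 0) (hf : ∀ e ∈ E(G), f e ∉ V(G))
    (hV : V(H) = V(G) ∪ f '' E(G)) (hE : E(H) = (fun e => insert (f e) e) '' E(G))
    {p : ℝ} (hp : (r : ℝ) < p) (hinj : Set.InjOn f E(G)) :
    H.pSpectralRadius (r + 1) (p + 1) ≤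
      ((((r : ℝ) + 1) / r) ^ (p - r) * G.pSpectralRadius r p ^ p) ^ (1 / (p + 1)) := by
  have hr0 : (0 : ℝ) < r := by exact_mod_cast Nat.pos_of_ne_zero hr
  have hp0 : 0 < p := hr0.trans hp
  have hq0 : 0 < p + 1 := by linarith
  have hHfin := finite_vertexSet_of_extension hfin hV
  obtain ⟨x, hx0, hx1, hxe⟩ := exists_nonneg_polyForm_eq hHfin
    (nonempty_vertexSet_of_extension hne hV) hq0 (r + 1)
  have hl0 : 0 ≤ G.pSpectralRadius r p := pSpectralRadius_nonneg hfin hne hp0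
  rw [sum_vertexSet_of_extension hfin hf hV hHfin] at hx1
  set a := ∑ v ∈ hfin.toFinset, x v ^ (p + 1) with ha
  set b := ∑ w ∈ ((edgeSet_finite hfin).image f).toFinset, x w ^ (p + 1) with hb
  have ha0 : 0 ≤ a := Finset.sum_nonneg fun v _ => Real.rpow_nonneg (hx0 v) _
  have hb0 : 0 ≤ b := Finset.sum_nonneg fun v _ => Real.rpow_nonneg (hx0 v) _
  have hbe : ∑ e ∈ (edgeSet_finite hfin).toFinset, x (f e) ^ (p + 1) = b := by
    rw [hb, ← finsum_mem_eq_finite_toFinset_sum, ← finsum_mem_eq_finite_toFinset_sum,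
      finsum_mem_image hinj]
  have hae : ∑ e ∈ (edgeSet_finite hfin).toFinset, (∏ᶠ v ∈ e, x v) ^ ((p + 1) / p) ≤
      G.pSpectralRadius r p / r * a ^ ((r : ℝ) / p) := by
    have h1 : ∀ e ∈ (edgeSet_finite hfin).toFinset, (∏ᶠ v ∈ e, x v) ^ ((p + 1) / p) =
        ∏ᶠ v ∈ e, x v ^ ((p + 1) / p) := fun e he =>
      (finprod_mem_rpow (edge_finite hfin (by simpa using he)) hx0 _).symm
    rw [Finset.sum_congr rfl h1, sum_edges_eq_div hfin hr, div_mul_eq_mul_div]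
    refine div_le_div_of_nonneg_right ?_ hr0.le
    refine (polyForm_le_mul_rpow hfin hne hunif hr hp0 _).trans (le_of_eq ?_)
    congr 2
    refine Finset.sum_congr rfl fun v _ => ?_
    rw [abs_of_nonneg (Real.rpow_nonneg (hx0 v) _), ← Real.rpow_mul (hx0 v),
      div_mul_cancel₀ _ hp0.ne']
  have hconj : (p + 1).HolderConjugate ((p + 1) / p) := by
    rw [Real.holderConjugate_iff]
    refine ⟨by linarith, ?_⟩
    field_simp
    ring
  have hholder := Real.inner_le_Lp_mul_Lq_of_nonneg (edgeSet_finite hfin).toFinset hconj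
    (f := fun e => x (f e)) (g := fun e => ∏ᶠ v ∈ e, x v) (fun e _ => hx0 _)
    fun e _ => finprod_mem_nonneg_of_nonneg hx0
  rw [hbe, one_div_div] at hholder
  have hA : (∑ e ∈ (edgeSet_finite hfin).toFinset, (∏ᶠ v ∈ e, x v) ^ ((p + 1) / p)) ^
      (p / (p + 1)) ≤ (G.pSpectralRadius r p / r) ^ (p / (p + 1)) * a ^ ((r : ℝ) / (p + 1)) := by
    refine (Real.rpow_le_rpow (Finset.sum_nonneg fun e _ => Real.rpow_nonneg
      (finprod_mem_nonneg_of_nonneg hx0) _) hae (by positivity)).trans (le_of_eq ?_)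
    rw [Real.mul_rpow (by positivity) (by positivity), ← Real.rpow_mul ha0]
    congr 2
    field_simp
  rw [← hxe, polyForm_of_extension hfin hf hE, ← mul_splitMax_rpow_mul hr hp hl0]
  calc _ ≤ ((r : ℝ) + 1) * (b ^ (1 / (p + 1)) *
        ((G.pSpectralRadius r p / r) ^ (p / (p + 1)) * a ^ ((r : ℝ) / (p + 1)))) := by
        refine mul_le_mul_of_nonneg_left (hholder.trans ?_) (by positivity)
        exact mul_le_mul_of_nonneg_left hA (by positivity)
    _ = ((r : ℝ) + 1) * (b ^ (1 / (p + 1)) * a ^ ((r : ℝ) / (p + 1))) *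
        (G.pSpectralRadius r p / r) ^ (p / (p + 1)) := by ring
    _ ≤ _ := by
        refine mul_le_mul_of_nonneg_right (mul_le_mul_of_nonneg_left ?_ (by positivity))
          (by positivity)
        exact rpow_mul_rpow_le_splitMax hr hq0 ha0 hb0 hx1

theorem upper_bound_of_extension (hfin : V(G).Finite) (hne : V(G).Nonempty)
    (hEne : E(G).Nonempty)
    (hunif : G.IsUniform r) (hr : r ≠ 0) (hf : ∀ e ∈ E(G), f e ∉ V(G))
    (hV : V(H) = V(G) ∪ f '' E(G)) (hE : E(H) = (fun e => insert (f e) e) '' E(G))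
    {p : ℝ} (hp : (r : ℝ) < p) :
    H.pSpectralRadius (r + 1) (p + 1) ≤
        (((r : ℝ) + 1) ^ (p - r) / (r : ℝ) ^ (p + 1 - r)) ^ (1 / (p + 1)) *
          G.pSpectralRadius r (p + 1) ∧
      ((¬ ∃ w, f '' E(G) = {w}) → H.pSpectralRadius (r + 1) (p + 1) <
        (((r : ℝ) + 1) ^ (p - r) / (r : ℝ) ^ (p + 1 - r)) ^ (1 / (p + 1)) *
          G.pSpectralRadius r (p + 1)) := by
  classical
  have hr0 : (0 : ℝ) < r := by exact_mod_cast Nat.pos_of_ne_zero hr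
  have hq0 : 0 < p + 1 := by linarith
  have hHfin := finite_vertexSet_of_extension hfin hV
  have hHne := nonempty_vertexSet_of_extension hne hV
  obtain ⟨x, hx0, hx1, hxe⟩ := exists_nonneg_polyForm_eq hHfin hHne hq0 (r + 1)
  have hl0 : 0 ≤ G.pSpectralRadius r (p + 1) := pSpectralRadius_nonneg hfin hne hq0
  have hpos : ∀ e ∈ E(H), ∀ v ∈ e, 0 < x v := fun e he v hv =>
    pos_of_polyForm_eq hHfin hHne (isUniform_of_extension hfin hunif hf hE) r.succ_ne_zero
      (by push_cast; linarith) hx0 hx1 hxe he hv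
  rw [sum_vertexSet_of_extension hfin hf hV hHfin] at hx1
  set a := ∑ v ∈ hfin.toFinset, x v ^ (p + 1) with ha
  set W := ((edgeSet_finite hfin).image f).toFinset with hW
  set b := ∑ w ∈ W, x w ^ (p + 1) with hb
  set F := (edgeSet_finite hfin).toFinset with hF
  have ha0 : 0 ≤ a := Finset.sum_nonneg fun v _ => Real.rpow_nonneg (hx0 v) _
  have hb0 : 0 ≤ b := Finset.sum_nonneg fun v _ => Real.rpow_nonneg (hx0 v) _
  have hroot : ∀ w, (x w ^ (p + 1)) ^ (1 / (p + 1)) = x w := fun w => by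
    rw [← Real.rpow_mul (hx0 w), mul_one_div_cancel hq0.ne', Real.rpow_one]
  have hmemW : ∀ e ∈ F, f e ∈ W := fun e he => by
    rw [hW, Set.Finite.mem_toFinset]
    exact Set.mem_image_of_mem f (by simpa [hF] using he)
  have hle : ∀ e ∈ F, x (f e) * ∏ᶠ v ∈ e, x v ≤ b ^ (1 / (p + 1)) * ∏ᶠ v ∈ e, x v := by
    intro e he
    refine mul_le_mul_of_nonneg_right ?_ (finprod_mem_nonneg_of_nonneg hx0)
    rw [← hroot (f e)]
    exact Real.rpow_le_rpow (Real.rpow_nonneg (hx0 _) _)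
      (Finset.single_le_sum (f := fun w => x w ^ (p + 1))
        (fun w _ => Real.rpow_nonneg (hx0 w) _) (hmemW e he)) (by positivity)
  have hfinal : ((r : ℝ) + 1) * ∑ e ∈ F, b ^ (1 / (p + 1)) * ∏ᶠ v ∈ e, x v ≤
      (((r : ℝ) + 1) ^ (p - r) / (r : ℝ) ^ (p + 1 - r)) ^ (1 / (p + 1)) *
        G.pSpectralRadius r (p + 1) := by
    rw [← Finset.mul_sum, hF, sum_edges_eq_div hfin hr, ← div_mul_splitMax_rpow hr hp]
    have h1 := polyForm_le_mul_rpow hfin hne hunif hr hq0 x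
    rw [Finset.sum_congr rfl fun v _ => by rw [abs_of_nonneg (hx0 v)], ← ha] at h1
    calc _ = ((r : ℝ) + 1) / r * (b ^ (1 / (p + 1)) * G.polyForm r x) := by ring
      _ ≤ ((r : ℝ) + 1) / r * (b ^ (1 / (p + 1)) *
          (G.pSpectralRadius r (p + 1) * a ^ ((r : ℝ) / (p + 1)))) := by gcongr
      _ = ((r : ℝ) + 1) / r * (b ^ (1 / (p + 1)) * a ^ ((r : ℝ) / (p + 1))) *
          G.pSpectralRadius r (p + 1) := by ring
      _ ≤ _ := by
        refine mul_le_mul_of_nonneg_right (mul_le_mul_of_nonneg_left ?_ (by positivity)) hl0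
        exact rpow_mul_rpow_le_splitMax hr hq0 ha0 hb0 hx1
  rw [← hxe, polyForm_of_extension hfin hf hE, ← hF]
  have hr1 : (0 : ℝ) < (r : ℝ) + 1 := by linarith
  refine ⟨(mul_le_mul_of_nonneg_left (Finset.sum_le_sum hle) hr1.le).trans hfinal, fun hnc =>
    (mul_lt_mul_of_pos_left (Finset.sum_lt_sum hle ?_) hr1).trans_le hfinal⟩
  obtain ⟨e, he⟩ := hEne
  have heF : e ∈ F := by simpa [hF] using he
  obtain ⟨e', he', hee'⟩ : ∃ e' ∈ E(G), f e' ≠ f e := by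
    by_contra! hall
    refine hnc ⟨f e, Set.Subset.antisymm ?_ ?_⟩
    · rintro _ ⟨e', he', rfl⟩
      exact hall e' he'
    · rintro _ rfl
      exact ⟨e, he, rfl⟩
  have heF' : e' ∈ F := by simpa [hF] using he'
  have hmemH : ∀ d ∈ E(G), insert (f d) d ∈ E(H) := fun d hd => by
    rw [hE]
    exact ⟨d, hd, rfl⟩
  refine ⟨e, heF, mul_lt_mul_of_pos_right ?_ ?_⟩
  · rw [← hroot (f e)]
    refine Real.rpow_lt_rpow (Real.rpow_nonneg (hx0 _) _) ?_ (by positivity)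
    exact Finset.single_lt_sum hee' (hmemW e heF) (hmemW e' heF')
      (Real.rpow_pos_of_pos (hpos _ (hmemH e' he') _ (Set.mem_insert _ _)) _)
      fun w _ _ => Real.rpow_nonneg (hx0 w) _
  · exact finprod_mem_pos_of_pos (edge_finite hfin he) fun v hv =>
      hpos _ (hmemH e he) v (Set.mem_insert_of_mem _ hv)

theorem upper_bound_le_of_image_eq_singleton (hfin : V(G).Finite) (hne : V(G).Nonempty)
    (hunif : G.IsUniform r) (hr : r ≠ 0) (hf : ∀ e ∈ E(G), f e ∉ V(G))
    (hV : V(H) = V(G) ∪ f '' E(G)) (hE : E(H) = (fun e => insert (f e) e) '' E(G))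
    {p : ℝ} (hp : (r : ℝ) < p) {w : α} (hw : f '' E(G) = {w}) :
    (((r : ℝ) + 1) ^ (p - r) / (r : ℝ) ^ (p + 1 - r)) ^ (1 / (p + 1)) *
        G.pSpectralRadius r (p + 1) ≤ H.pSpectralRadius (r + 1) (p + 1) := by
  have hr0 : (0 : ℝ) < r := by exact_mod_cast Nat.pos_of_ne_zero hr
  have hq0 : 0 < p + 1 := by linarith
  obtain ⟨x, hx0, hx1, hxe⟩ := exists_nonneg_polyForm_eq hfin hne hq0 r
  have h := le_pSpectralRadius_of_extension hfin hne hunif hr hf hV hE hq0 (g := fun _ => 1)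
    hx0 (fun _ => zero_le_one) hx1 one_pos (by simp [hw])
  refine le_trans (le_of_eq ?_) h
  simp only [one_mul, Real.one_rpow, mul_one]
  rw [sum_edges_eq_div hfin hr, hxe, ← div_mul_splitMax_rpow hr hp]
  ring

end Bounds

end Hypergraph

theorem mainTheorem10 {α : Type*} (G H : Hypergraph α) (r : ℕ) (p : ℝ)
    (hfin : G.vertexSet.Finite) (hne : G.vertexSet.Nonempty)
    (hunif : G.IsUniform r)
    (hiso : ∀ v ∈ G.vertexSet, ¬ G.IsIsolated v)
    (hH : G.IsExtension H)
    (hp : (r : ℝ) < p) :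
    (((((r : ℝ) + 1) / r) ^ (p - r) * (G.pSpectralRadius r p) ^ p) ^ (1 / (p + 1))
        ≤ H.pSpectralRadius (r + 1) (p + 1)) ∧
    (H.pSpectralRadius (r + 1) (p + 1)
        ≤ (((r : ℝ) + 1) ^ (p - r) / (r : ℝ) ^ (p + 1 - r)) ^ (1 / (p + 1))
          * G.pSpectralRadius r (p + 1)) ∧
    ((((((r : ℝ) + 1) / r) ^ (p - r) * (G.pSpectralRadius r p) ^ p) ^ (1 / (p + 1))
        = H.pSpectralRadius (r + 1) (p + 1)) ↔ H.Isomorphic G.generalizedPower) ∧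
    ((H.pSpectralRadius (r + 1) (p + 1)
        = (((r : ℝ) + 1) ^ (p - r) / (r : ℝ) ^ (p + 1 - r)) ^ (1 / (p + 1))
          * G.pSpectralRadius r (p + 1)) ↔ H.Isomorphic (G.starProduct Hypergraph.kOne)) := by
  obtain ⟨f, hf, hV, hE⟩ := hH
  obtain ⟨e, he, hr⟩ : ∃ e ∈ G.edgeSet, r ≠ 0 := by
    obtain ⟨v, hv⟩ := hne
    obtain ⟨e, he, hve⟩ : ∃ e ∈ G.edgeSet, v ∈ e := by
      simpa [Hypergraph.IsIsolated] using hiso v hv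
    refine ⟨e, he, ?_⟩
    rw [← hunif e he]
    exact Set.ncard_ne_zero_of_mem hve (Hypergraph.edge_finite hfin he)
  have hlow := Hypergraph.lower_bound_of_extension hfin hne ⟨e, he⟩ hunif hr hf hV hE hp
  have hup := Hypergraph.upper_bound_of_extension hfin hne ⟨e, he⟩ hunif hr hf hV hE hp
  refine ⟨hlow.1, hup.1, ?_, ?_⟩
  · rw [Hypergraph.isomorphic_generalizedPower_iff hfin hf hV hE]
    refine ⟨fun h => ?_, fun h => ?_⟩
    · by_contra hn
      exact (hlow.2 hn).ne h
    · exact le_antisymm hlow.1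
        (Hypergraph.le_lower_bound_of_injOn hfin hne hunif hr hf hV hE hp h)
  · rw [Hypergraph.isomorphic_starProduct_kOne_iff hfin hf hV hE]
    refine ⟨fun h => ?_, fun ⟨w, hw⟩ => ?_⟩
    · by_contra hn
      exact (hup.2 hn).ne h
    · exact le_antisymm hup.1
        (Hypergraph.upper_bound_le_of_image_eq_singleton hfin hne hunif hr hf hV hE hp hw)
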